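/- **Setting.** An aerial user is at height $h_U$ above the origin of the plane, with $h_T<h_U<h_A$; put $h_{UT}=h_U-h_T$ and $h_{UA}=h_A-h_U$. Terrestrial base stations (BSs) at height $h_T$ have horizontal positions forming a homogeneous Poisson point process on $\mathbb R^2$ of density $\lambda_T>0$. Independently of each other, a terrestrial BS at horizontal distance $z$ is in line of sight (tier $L$) with probability $P_L(z)=-a\exp(-b\arctan(h_{UT}/z))+c$ (truncated to $[0,1]$ should it leave this interval) and otherwise belongs to tier $N$. There are $N\ge 1$ aerial BSs (tier $A$) at height $h_A$, with i.i.d. horizontal positions uniform on the disc of radius $r_D>0$ about the origin; put $d=\sqrt{r_D^2+h_{UA}^2}$. A BS $x$ of tier $\nu$ at distance $d_x$ from the user has channel power gain $H_x\sim\mathrm{Gamma}(m_\nu,1/m_\nu)$ (shape, scale), with $m_\nu>0$. An interfering aerial BS has antenna gain $G_x=G_m^A>0$ with probability $q_A=\theta_B^A/180$ and $G_x=g_s^A\ge0$ with probability $1-q_A$, where $\theta_B^A\in[0,180]$. Positions, line-of-sight indicators (given positions), channel gains and antenna gains are independent. Transmit powers $P_T,P_A$, excess losses $\eta_\nu$,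 the terrestrial sidelobe gain $g_s^T$ and path-loss exponents $\alpha_\nu$ are positive. Put $\mu_\nu=P_T\eta_\nu g_s^T$ for $\nu\in\{L,N\}$ and $\mu_A=P_AG_m^A\eta_A$. The serving BS $x_0$ maximizes $\mu_\nu d_x^{-\alpha_\nu}$ over all BSs $x$ ($\nu$ the tier of $x$); $\mathcal E_\nu$ is the event that $x_0$ belongs to tier $\nu$, and $\tilde R=d_{x_0}$. An interfering BS $x\ne x_0$ contributes power $\mu_\nu H_xd_x^{-\alpha_\nu}$ if it is of tier $\nu\in\{L,N\}$, and $P_AG_x\eta_AH_xd_x^{-\alpha_A}$ if it is of tier $A$. The interference $I\in[0,\infty]$ is the sum of these powers over all BSs $x\neq x_0$ under non-orthogonal spectrum sharing (N-OSS), and, under orthogonal sharing (OSS), only over the BSs $x\ne x_0$ that are terrestrial if $x_0$ is terrestrial, aerial if $x_0$ is aerial. Let $\sigma^2\ge0$ be the noise power, $V=I+\sigma^2$, and on $\mathcal E_\nu$ let $\gamma=\mu_\nu H_{x_0}\tilde R^{-\alpha_\nu}/V$ be the SINR. **Theorem.** Fix either sharing policy, a tier $\nu\in\{L,N,A\}$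 with $m_\nu$ a positive integer and $\mathbb P(\mathcal E_\nu)>0$, and a threshold $T>0$. Given $\mathcal E_\nu$, the serving distance $\tilde R$ has a density $f_{\tilde R_\nu|\mathcal E_\nu}$, and $\tilde R$ lies almost surely in $\mathfrak R_\nu$, where $$\mathfrak R_L=[h_{UT},\zeta^L(d)],\qquad \mathfrak R_A=[h_{UA},d],\qquad \mathfrak R_N=[h_{UT},\max\{d,\zeta^N(d)\}],\qquad \zeta^\omega(x)=\Big(\frac{\mu_\omega x^{\alpha_A}}{\mu_A}\Big)^{1/\alpha_\omega}.$$ Let $\mathcal L_{V|\mathcal E_\nu}(s)=\mathcal L_{V|\mathcal E_\nu}(s;r)=\mathbb E[e^{-sV}\mid\mathcal E_\nu,\tilde R=r]$, the Laplace transform of a regular conditional distribution of $V$, and define $\mathcal L_{I|\mathcal E_\nu}$ in the same way. Then $\mathcal L_{V|\mathcal E_\nu}(s)=e^{-\sigma^2s}\mathcal L_{I|\mathcal E_\nu}(s)$ for all $s>0$ and almost every $r$ (for the law of $\tilde R$ given $\mathcal E_\nu$), $\mathcal L_{V|\mathcal E_\nu}$ is smooth in $s>0$, and the coverage probability $\mathcal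 C_\nu=\mathbb P(\gamma\ge T\mid\mathcal E_\nu)$ is $$\mathcal C_\nu=\sum_{k=0}^{m_\nu-1}\frac{(-1)^k}{k!}\Big(\frac{m_\nu T}{\mu_\nu}\Big)^k\int_{\mathfrak R_\nu}r^{k\alpha_\nu}\Big[\frac{\partial^k}{\partial s^k}\mathcal L_{V|\mathcal E_\nu}(s)\Big]_{s=m_\nu Tr^{\alpha_\nu}/\mu_\nu}f_{\tilde R_\nu|\mathcal E_\nu}(r)\,dr ,$$ where all the integrals converge absolutely. -/

import Mathlib

open MeasureTheory ProbabilityTheory Set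
open scoped ENNReal

namespace VHetNet

/-- The three tiers: line-of-sight terrestrial, non-line-of-sight terrestrial, aerial. -/
inductive Tier
  | L
  | N
  | A
  deriving DecidableEq

/-- The two spectrum sharing policies: non-orthogonal and orthogonal. -/
inductive Policy
  | NOSS
  | OSS
  deriving DecidableEq

/-- The horizontal plane. -/
abbrev Plane : Type := EuclideanSpace ℝ (Fin 2)

/-- Elevation angle at which a user at relative height `h > 0` is seen from horizontal
distance `z`, i.e. `arctan (h / z)`, with the limiting value `π / 2` at `z = 0`. -/
noncomputable def elevation (h z : ℝ) : ℝ :=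
  if z = 0 then Real.pi / 2 else Real.arctan (h / z)

/-- The deterministic parameters of the network. -/
structure Params where
  /-- density of the terrestrial base stations -/
  lamT : ℝ
  /-- heights of the terrestrial base stations, the user and the aerial base stations -/
  hT : ℝ
  hU : ℝ
  hA : ℝ
  /-- radius of the disc of aerial base stations, and their number -/
  rD : ℝ
  numA : ℕ
  /-- transmit powers -/
  PT : ℝ
  PA : ℝ
  /-- excess losses -/
  eta : Tier → ℝ
  /-- path-loss exponents -/
  alpha : Tier → ℝ
  /-- Nakagami fading parameters -/
  m : Tier → ℝ
  /-- sidelobe gain of the terrestrial antennas (the gain that applies at the user) -/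
  gsT : ℝ
  /-- mainlobe and sidelobe gains of the aerial antennas -/
  GmA : ℝ
  gsA : ℝ
  /-- beamwidth, in degrees, of the aerial antennas -/
  thetaB : ℝ
  /-- environment parameters of the line-of-sight probability -/
  a : ℝ
  b : ℝ
  c : ℝ
  /-- noise power -/
  sigma2 : ℝ
  lamT_pos : 0 < lamT
  hT_lt_hU : hT < hU
  hU_lt_hA : hU < hA
  rD_pos : 0 < rD
  numA_pos : 0 < numA
  PT_pos : 0 < PT
  PA_pos : 0 < PA
  eta_pos : ∀ ν, 0 < eta ν
  alpha_pos : ∀ ν, 0 < alpha ν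
  m_pos : ∀ ν, 0 < m ν
  gsT_pos : 0 < gsT
  GmA_pos : 0 < GmA
  gsA_nonneg : 0 ≤ gsA
  thetaB_mem : thetaB ∈ Icc (0 : ℝ) 180
  sigma2_nonneg : 0 ≤ sigma2

namespace Params

variable (p : Params)

/-- Height of the user relative to the terrestrial base stations. -/
def hUT : ℝ := p.hU - p.hT

/-- Height of the aerial base stations relative to the user. -/
def hUA : ℝ := p.hA - p.hU

/-- Largest possible distance between the user and an aerial base station. -/
noncomputable def d : ℝ := Real.sqrt (p.rD ^ 2 + p.hUA ^ 2)

/-- Line-of-sight probability at horizontal distance `z`. -/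
noncomputable def PL (z : ℝ) : ℝ := -p.a * Real.exp (-p.b * elevation p.hUT z) + p.c

/-- Probability that the mainlobe of an interfering aerial base station points at the user. -/
noncomputable def qA : ℝ := p.thetaB / 180

/-- `μ_ν`: transmit power times excess loss times gain of a serving base station of tier `ν`. -/
def mu : Tier → ℝ
  | .L => p.PT * p.eta .L * p.gsT
  | .N => p.PT * p.eta .N * p.gsT
  | .A => p.PA * p.GmA * p.eta .A

/-- `ζ^ν_A(x)`: the distance at which a base station of tier `ν` has the same mean received
power as a serving aerial base station at distance `x`. -/
noncomputable def zetaA (ν : Tier) (x : ℝ) : ℝ :=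
  (p.mu ν * x ^ p.alpha .A / p.mu .A) ^ (1 / p.alpha ν)

/-- The range of the serving distance for each tier. -/
noncomputable def servRange : Tier → Set ℝ
  | .L => Icc p.hUT (p.zetaA .L p.d)
  | .N => Icc p.hUT (max p.d (p.zetaA .N p.d))
  | .A => Icc p.hUA p.d

end Params

section Poisson

variable {Ω E : Type*} [MeasurableSpace Ω] [MeasurableSpace E]

/-- Number of points of the enumerated point process `X` that lie in `B`. -/
noncomputable def count (X : ℕ → Ω → E) (B : Set E) (ω : Ω) : ℕ∞ :=
  {j : ℕ | X j ω ∈ B}.encard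

/-- The points `X 0, X 1, …` form a Poisson point process with intensity measure `Λ`
(`Λ` has infinite total mass for such an enumeration to exist): counts are Poisson
distributed, and counts in disjoint sets are independent. -/
structure IsPoissonProcess (X : ℕ → Ω → E) (Λ : Measure E) (P : Measure Ω) : Prop where
  measurable : ∀ j, Measurable (X j)
  count_law : ∀ B : Set E, MeasurableSet B → Λ B ≠ ∞ → ∀ n : ℕ,
    P {ω | count X B ω = n} =
      ENNReal.ofReal (Real.exp (-(Λ B).toReal) * (Λ B).toReal ^ n / (n.factorial : ℝ))
  count_indep : ∀ (k : ℕ) (B : Fin k → Set E), (∀ i, MeasurableSet (B i)) →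
    (∀ i i', i ≠ i' → Disjoint (B i) (B i')) → iIndepFun (fun i ω => count X (B i) ω) P

end Poisson

/-- Labels of the independent sources of randomness in a network with `n` aerial
base stations. -/
inductive Source (n : ℕ)
  | sites
  | los (j : ℕ)
  | fadeL (j : ℕ)
  | fadeN (j : ℕ)
  | pos (i : Fin n)
  | fadeA (i : Fin n)
  | gain (i : Fin n)

/-- The random network on the probability space `(Ω, P)`. The user is at horizontal
position `0`. -/
structure Network (p : Params) {Ω : Type*} [MeasurableSpace Ω] (P : Measure Ω) where
  /-- horizontal positions of the terrestrial base stations -/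
  X : ℕ → Ω → Plane
  /-- uniform marks that decide about line of sight -/
  U : ℕ → Ω → ℝ
  /-- channel power gains of the terrestrial base stations, under line of sight and
  without it -/
  HL : ℕ → Ω → ℝ
  HN : ℕ → Ω → ℝ
  /-- horizontal positions of the aerial base stations -/
  Y : Fin p.numA → Ω → Plane
  /-- channel power gains of the aerial base stations -/
  HA : Fin p.numA → Ω → ℝ
  /-- antenna gains of the aerial base stations when they interfere -/
  G : Fin p.numA → Ω → ℝ
  X_poisson : IsPoissonProcess X (ENNReal.ofReal p.lamT • (volume : Measure Plane)) P
  U_meas : ∀ j, Measurable (U j)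
  U_law : ∀ j, P.map (U j) = (volume : Measure ℝ).restrict (Icc 0 1)
  HL_meas : ∀ j, Measurable (HL j)
  HL_law : ∀ j, P.map (HL j) = gammaMeasure (p.m .L) (p.m .L)
  HN_meas : ∀ j, Measurable (HN j)
  HN_law : ∀ j, P.map (HN j) = gammaMeasure (p.m .N) (p.m .N)
  Y_meas : ∀ i, Measurable (Y i)
  Y_law : ∀ i, P.map (Y i) = ProbabilityTheory.cond (volume : Measure Plane)
    (Metric.closedBall 0 p.rD)
  HA_meas : ∀ i, Measurable (HA i)
  HA_law : ∀ i, P.map (HA i) = gammaMeasure (p.m .A) (p.m .A)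
  G_meas : ∀ i, Measurable (G i)
  G_law : ∀ i, P.map (G i) =
    ENNReal.ofReal p.qA • Measure.dirac p.GmA + ENNReal.ofReal (1 - p.qA) • Measure.dirac p.gsA
  indep : iIndep (fun s : Source p.numA => match s with
    | .sites => MeasurableSpace.comap (fun ω j => X j ω) inferInstance
    | .los j => MeasurableSpace.comap (U j) inferInstance
    | .fadeL j => MeasurableSpace.comap (HL j) inferInstance
    | .fadeN j => MeasurableSpace.comap (HN j) inferInstance
    | .pos i => MeasurableSpace.comap (Y i) inferInstance
    | .fadeA i => MeasurableSpace.comap (HA i) inferInstance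
    | .gain i => MeasurableSpace.comap (G i) inferInstance) P

namespace Network

variable {p : Params} {Ω : Type*} [MeasurableSpace Ω] {P : Measure Ω} (W : Network p P)

/-- Base stations: `Sum.inl j` are the terrestrial ones, `Sum.inr i` the aerial ones. -/
abbrev BS (p : Params) : Type := ℕ ⊕ Fin p.numA

open Classical in
/-- Tier of a base station; a terrestrial one at horizontal distance `z` is in line of
sight with probability `PL z`, independently of everything else. (If the environment
parameters are such that `PL z` is not in `[0, 1]`, it acts as `0` or as `1`.) -/
noncomputable def tier : BS p → Ω → Tier
  | .inl j, ω => if W.U j ω ≤ p.PL ‖W.X j ω‖ then .L else .N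
  | .inr _, _ => .A

/-- Distance between the user and a base station. -/
noncomputable def dist : BS p → Ω → ℝ
  | .inl j, ω => Real.sqrt (‖W.X j ω‖ ^ 2 + p.hUT ^ 2)
  | .inr i, ω => Real.sqrt (‖W.Y i ω‖ ^ 2 + p.hUA ^ 2)

/-- Channel power gain of a base station. -/
noncomputable def fading : BS p → Ω → ℝ
  | .inl j, ω => match W.tier (.inl j) ω with
    | .L => W.HL j ω
    | _ => W.HN j ω
  | .inr i, ω => W.HA i ω

/-- Long-term averaged received power that a base station offers when it serves. -/
noncomputable def meanPower (b : BS p) (ω : Ω) : ℝ :=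
  p.mu (W.tier b ω) * W.dist b ω ^ (-p.alpha (W.tier b ω))

/-- Received power of the useful signal when the base station serves. -/
noncomputable def signal (b : BS p) (ω : Ω) : ℝ :=
  p.mu (W.tier b ω) * W.fading b ω * W.dist b ω ^ (-p.alpha (W.tier b ω))

/-- Received power from a base station when it interferes. -/
noncomputable def interfPower : BS p → Ω → ℝ
  | .inl j, ω => p.mu (W.tier (.inl j) ω) * W.fading (.inl j) ω *
      W.dist (.inl j) ω ^ (-p.alpha (W.tier (.inl j) ω))
  | .inr i, ω => p.PA * W.G i ω * p.eta .A * W.HA i ω * W.dist (.inr i) ω ^ (-p.alpha .A)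

/-- The base station offers the largest mean received power. -/
def IsStrongest (b : BS p) (ω : Ω) : Prop :=
  ∀ b', W.meanPower b' ω ≤ W.meanPower b ω

/-- The base station serves the user: it is the strongest one (ties, which have
probability zero, are broken by the enumeration of the base stations). -/
def IsServing (b : BS p) (ω : Ω) : Prop :=
  W.IsStrongest b ω ∧
    ∀ b', W.IsStrongest b' ω → Encodable.encode b ≤ Encodable.encode b'

open Classical in
/-- The serving base station `x₀` (it exists almost surely). -/
noncomputable def serving (ω : Ω) : BS p :=
  if h : ∃ b, W.IsServing b ω then h.choose else .inl 0

/-- The event `E_ν` that the serving base station belongs to tier `ν`. -/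
def assocEvent (ν : Tier) : Set Ω :=
  {ω | ∃ b, W.IsServing b ω ∧ W.tier b ω = ν}

/-- Distance between the user and the serving base station. -/
noncomputable def servDist (ω : Ω) : ℝ := W.dist (W.serving ω) ω

/-- Base station `b` shares its spectrum with base station `b₀`. -/
def Shares (pol : Policy) (b₀ b : BS p) : Prop :=
  match pol with
  | .NOSS => True
  | .OSS => b₀.isRight = b.isRight

open Classical in
/-- Aggregate interference power, possibly infinite: all base stations except the serving
one that use its spectrum. -/
noncomputable def interference (pol : Policy) (ω : Ω) : ℝ≥0∞ :=
  ∑' b : BS p, if b ≠ W.serving ω ∧ Shares pol (W.serving ω) b then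
    ENNReal.ofReal (W.interfPower b ω) else 0

/-- Interference plus noise, `V = I + σ²`. -/
noncomputable def interfNoise (pol : Policy) (ω : Ω) : ℝ≥0∞ :=
  W.interference pol ω + ENNReal.ofReal p.sigma2

/-- Signal to interference plus noise ratio at the user. -/
noncomputable def sinr (pol : Policy) (ω : Ω) : ℝ≥0∞ :=
  ENNReal.ofReal (W.signal (W.serving ω) ω) / W.interfNoise pol ω

/-- Conditional coverage probability given association with tier `ν`, at threshold `T`. -/
noncomputable def coverage (pol : Policy) (ν : Tier) (T : ℝ) : ℝ :=
  (P[|W.assocEvent ν]).real {ω | ENNReal.ofReal T ≤ W.sinr pol ω}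

/-- Conditional law of the serving distance given association with tier `ν`. -/
noncomputable def servDistLaw (ν : Tier) : Measure ℝ :=
  (P[|W.assocEvent ν]).map W.servDist

/-- Conditional density of the serving distance given association with tier `ν`
(the density of the absolutely continuous part of the conditional law). -/
noncomputable def servDistDensity (ν : Tier) (r : ℝ) : ℝ :=
  ((W.servDistLaw ν).rnDeriv volume r).toReal

end Network

/-- `exp (-s v)` for `s > 0` and `v ∈ [0, ∞]`, with `exp (-∞) = 0`. -/
noncomputable def expNeg (s : ℝ) (v : ℝ≥0∞) : ℝ :=
  if v = ∞ then 0 else Real.exp (-(s * v.toReal))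

namespace Network

variable {p : Params} {Ω : Type*} [MeasurableSpace Ω] {P : Measure Ω} (W : Network p P)

/-- `s ↦ condLaplace Z ν r s` is the Laplace transform of the conditional law of `Z` given
association with tier `ν` and a serving distance equal to `r`. -/
noncomputable def condLaplace (Z : Ω → ℝ≥0∞) (ν : Tier) (r s : ℝ) : ℝ :=
  ∫ v, expNeg s v ∂(condDistrib Z W.servDist (P[|W.assocEvent ν]) r)

end Network

end VHetNet

/-! The coverage event is a comparison between the fading gain `H` of the serving base station and
a multiple `z` of interference plus noise, the multiple being determined by the serving distance.
Splitting the association event according to which base station `b` serves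
(`servesInTier`), everything but `H` is measurable with respect to the σ-algebra generated by all
sources of randomness other than the fading of `b`: the association depends on positions and
line-of-sight marks only, and the gain of `b` does not enter the interference. Hence `H` may be
averaged out with its tail (`measure_servesInTier_inter_covered`), and for a natural shape parameter
`m` the gamma law has the Erlang tail `∑_{k < m} (m z) ^ k / k! * exp (-m z)`
(`gammaMeasure_Ici`). Summing over `b` writes the coverage probability as the mean of this tail
(`coverage_eq_integral_erlangTail`).

Each summand of the tail is, up to sign and powers of the distance, a derivative
`(-v) ^ k * exp (-s v)` of the kernel of the Laplace transform (`expNegDeriv`). These derivatives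
are bounded by `k! / s ^ k`, uniformly in `v ∈ [0, ∞]`. The bound allows for differentiation under the
integral sign, with no moment assumption on the interference, which may even be infinite; it also
makes all integrals over the serving distance converge, since at `s = c r ^ α` the weight
`r ^ (k α)` compensates the factor `s ^ (-k)`. The regular conditional distribution given the
serving distance then turns the means into the integrals of the formula
(`integral_rpow_mul_expNegDeriv`).

The serving distance has a density because every single distance has one: a point of the Poisson
process misses null sets by the void probabilities, and the map `x ↦ √(‖x‖² + h²)` pulls null sets
back to null sets by polar coordinates. Its range follows from the comparison of the serving base
station with an aerial one, whose distance is at most `d`.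
-/

/-! ### Laplace transforms of laws on `[0, ∞]` -/

namespace VHetNet

/-- The `k`-th derivative of `s ↦ exp (-s v)`, namely `(-v) ^ k * exp (-s v)`, which is `0` at
`v = ∞`, as `expNeg` is. -/
noncomputable def expNegDeriv (k : ℕ) (s : ℝ) (v : ℝ≥0∞) : ℝ :=
  (-v.toReal) ^ k * expNeg s v

lemma expNegDeriv_zero (s : ℝ) : expNegDeriv 0 s = expNeg s := by
  ext v
  simp [expNegDeriv]

lemma expNegDeriv_top (k : ℕ) (s : ℝ) : expNegDeriv k s ∞ = 0 := by
  simp [expNegDeriv, expNeg]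

lemma expNegDeriv_of_ne_top (k : ℕ) (s : ℝ) {v : ℝ≥0∞} (hv : v ≠ ∞) :
    expNegDeriv k s v = (-v.toReal) ^ k * Real.exp (-(s * v.toReal)) := by
  simp [expNegDeriv, expNeg, hv]

lemma hasDerivAt_expNegDeriv (k : ℕ) (s : ℝ) (v : ℝ≥0∞) :
    HasDerivAt (fun s => expNegDeriv k s v) (expNegDeriv (k + 1) s v) s := by
  by_cases hv : v = ∞
  · subst hv
    simpa only [expNegDeriv_top] using hasDerivAt_const s (0 : ℝ)
  · simp only [expNegDeriv_of_ne_top _ _ hv]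
    have h : HasDerivAt (fun s : ℝ => -(s * v.toReal)) (-(1 * v.toReal)) s :=
      ((hasDerivAt_id s).mul_const v.toReal).neg
    exact (h.exp.const_mul ((-v.toReal) ^ k)).congr_deriv (by ring)

/-- Since `x ^ k / k! ≤ exp x`, the derivatives of `s ↦ exp (-s v)` are bounded uniformly in `v`. -/
lemma norm_expNegDeriv_le (k : ℕ) {s t : ℝ} (ht : 0 < t) (hts : t ≤ s) (v : ℝ≥0∞) :
    ‖expNegDeriv k s v‖ ≤ k.factorial / t ^ k := by
  by_cases hv : v = ∞
  · subst hv
    rw [expNegDeriv_top, norm_zero]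
    positivity
  · rw [expNegDeriv_of_ne_top _ _ hv, norm_mul, norm_pow, norm_neg, Real.norm_eq_abs,
      Real.norm_eq_abs, Real.abs_exp, abs_of_nonneg ENNReal.toReal_nonneg,
      le_div_iff₀ (by positivity)]
    have hx : 0 ≤ v.toReal := ENNReal.toReal_nonneg
    have h1 := Real.pow_div_factorial_le_exp (t * v.toReal) (by positivity) k
    rw [div_le_iff₀ (by positivity)] at h1
    have h2 : Real.exp (-(s * v.toReal)) ≤ Real.exp (-(t * v.toReal)) :=
      Real.exp_le_exp.2 (by nlinarith)
    calc v.toReal ^ k * Real.exp (-(s * v.toReal)) * t ^ k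
        = (t * v.toReal) ^ k * Real.exp (-(s * v.toReal)) := by ring
      _ ≤ (Real.exp (t * v.toReal) * k.factorial) * Real.exp (-(t * v.toReal)) := by gcongr
      _ = k.factorial * (Real.exp (t * v.toReal) * Real.exp (-(t * v.toReal))) := by ring
      _ = k.factorial := by rw [← Real.exp_add]; simp

@[fun_prop]
lemma measurable_expNegDeriv (k : ℕ) : Measurable fun q : ℝ × ℝ≥0∞ => expNegDeriv k q.1 q.2 := by
  unfold expNegDeriv expNeg
  have h : MeasurableSet {q : ℝ × ℝ≥0∞ | q.2 = ∞} := measurable_snd (measurableSet_singleton ∞)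
  exact (measurable_snd.ennreal_toReal.neg.pow_const k).mul (Measurable.ite h measurable_const
    (Real.measurable_exp.comp (measurable_fst.mul measurable_snd.ennreal_toReal).neg))

lemma measurable_expNegDeriv_right (k : ℕ) (s : ℝ) : Measurable (expNegDeriv k s) :=
  (measurable_expNegDeriv k).comp measurable_prodMk_left

lemma integrable_expNegDeriv (κ : Measure ℝ≥0∞) [IsFiniteMeasure κ] (k : ℕ) {s : ℝ} (hs : 0 < s) :
    Integrable (expNegDeriv k s) κ :=
  Integrable.of_bound (measurable_expNegDeriv_right k s).aestronglyMeasurable _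
    (Filter.Eventually.of_forall (norm_expNegDeriv_le k hs le_rfl))

lemma hasDerivAt_integral_expNegDeriv (κ : Measure ℝ≥0∞) [IsFiniteMeasure κ] (k : ℕ) {s : ℝ}
    (hs : 0 < s) :
    HasDerivAt (fun s => ∫ v, expNegDeriv k s v ∂κ) (∫ v, expNegDeriv (k + 1) s v ∂κ) s := by
  refine (hasDerivAt_integral_of_dominated_loc_of_deriv_le (s := Ioi (s / 2))
    (bound := fun _ => (k + 1).factorial / (s / 2) ^ (k + 1)) (Ioi_mem_nhds (by linarith))
    (Filter.Eventually.of_forall fun t => (measurable_expNegDeriv_right k t).aestronglyMeasurable)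
    (integrable_expNegDeriv κ k hs) (measurable_expNegDeriv_right _ s).aestronglyMeasurable
    (Filter.Eventually.of_forall fun v t ht => norm_expNegDeriv_le (k + 1) (by linarith)
      (le_of_lt ht) v) (integrable_const _)
    (Filter.Eventually.of_forall fun v t _ => hasDerivAt_expNegDeriv k t v)).2

lemma iteratedDeriv_integral_expNeg (κ : Measure ℝ≥0∞) [IsFiniteMeasure κ] (k : ℕ) :
    ∀ s : ℝ, 0 < s →
      iteratedDeriv k (fun s => ∫ v, expNeg s v ∂κ) s = ∫ v, expNegDeriv k s v ∂κ := by
  induction k with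
  | zero => intro s _; simp [expNegDeriv_zero]
  | succ k ih =>
    intro s hs
    rw [iteratedDeriv_succ, ← (hasDerivAt_integral_expNegDeriv κ k hs).deriv]
    refine Filter.EventuallyEq.deriv_eq ?_
    filter_upwards [Ioi_mem_nhds hs] with t ht using ih t ht

lemma contDiffOn_integral_expNeg (κ : Measure ℝ≥0∞) [IsFiniteMeasure κ] :
    ContDiffOn ℝ (⊤ : ℕ∞) (fun s => ∫ v, expNeg s v ∂κ) (Ioi 0) := by
  have key : ∀ n k : ℕ, ContDiffOn ℝ n (fun s => ∫ v, expNegDeriv k s v ∂κ) (Ioi 0) := by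
    intro n
    induction n with
    | zero =>
      intro k
      exact contDiffOn_zero.2 fun s hs =>
        (hasDerivAt_integral_expNegDeriv κ k hs).continuousAt.continuousWithinAt
    | succ n ih =>
      intro k
      push_cast
      refine (contDiffOn_succ_iff_deriv_of_isOpen isOpen_Ioi).2 ⟨fun s hs =>
        (hasDerivAt_integral_expNegDeriv κ k hs).differentiableAt.differentiableWithinAt,
        by simp, (ih (k + 1)).congr fun s hs =>
          (hasDerivAt_integral_expNegDeriv κ k hs).deriv⟩
  refine contDiffOn_infty.2 fun n => ?_
  simpa only [expNegDeriv_zero] using key n 0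

/-! ### The tail of the Erlang distribution -/

/-- The complementary distribution function of the gamma law with natural shape `n` and rate `r`
(the Erlang law), extended by `0` to the argument `∞`. -/
noncomputable def erlangTail (n : ℕ) (r : ℝ) (z : ℝ≥0∞) : ℝ :=
  ∑ k ∈ Finset.range n, (r * z.toReal) ^ k / k.factorial * expNeg r z

lemma hasDerivAt_erlang_sum (r x : ℝ) (n : ℕ) :
    HasDerivAt
      (fun x => -∑ k ∈ Finset.range (n + 1), (r * x) ^ k / k.factorial * Real.exp (-(r * x)))
      (r * ((r * x) ^ n / n.factorial * Real.exp (-(r * x)))) x := by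
  have hexp : HasDerivAt (fun x => Real.exp (-(r * x))) (Real.exp (-(r * x)) * (-r)) x := by
    have h : HasDerivAt (fun x : ℝ => -(r * x)) (-(r * 1)) x :=
      ((hasDerivAt_id x).const_mul r).neg
    simpa using h.exp
  induction n with
  | zero =>
    refine (hexp.neg.congr_deriv (by simp [mul_comm])).congr_of_eventuallyEq
      (Filter.Eventually.of_forall fun y => ?_)
    simp
  | succ n ih =>
    have hpow : HasDerivAt (fun x => (r * x) ^ (n + 1) / ((n + 1).factorial : ℝ))
        (((n + 1 : ℕ) : ℝ) * (r * x) ^ n * r / ((n + 1).factorial : ℝ)) x := by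
      have h : HasDerivAt (fun x : ℝ => r * x) (r * 1) x := (hasDerivAt_id x).const_mul r
      simpa using (h.pow (n + 1)).div_const ((n + 1).factorial : ℝ)
    have h := ih.add (hpow.mul hexp).neg
    simp only [Finset.sum_range_succ _ (n + 1)]
    refine (h.congr_deriv ?_).congr_of_eventuallyEq (Filter.Eventually.of_forall fun y => ?_)
    · have h1 : ((n.factorial : ℕ) : ℝ) ≠ 0 := by positivity
      have h2 : ((n : ℝ) + 1) ≠ 0 := by positivity
      rw [Nat.factorial_succ]
      push_cast
      field_simp
      ring
    · simp only [Pi.add_apply, Pi.neg_apply, Pi.mul_apply]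
      ring

lemma gammaMeasure_Ici {n : ℕ} (hn : 0 < n) {r : ℝ} (hr : 0 < r) {x : ℝ} (hx : 0 ≤ x) :
    gammaMeasure n r (Ici x) = ENNReal.ofReal
      (∑ k ∈ Finset.range n, (r * x) ^ k / k.factorial * Real.exp (-(r * x))) := by
  obtain ⟨n, rfl⟩ : ∃ m, n = m + 1 := ⟨n - 1, by omega⟩
  set g : ℝ → ℝ := fun x =>
    -∑ k ∈ Finset.range (n + 1), (r * x) ^ k / k.factorial * Real.exp (-(r * x)) with hg
  have hpdf : ∀ y ∈ Ici x, gammaPDF ((n + 1 : ℕ) : ℝ) r y =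
      ENNReal.ofReal (r * ((r * y) ^ n / n.factorial * Real.exp (-(r * y)))) := by
    intro y hy
    rw [gammaPDF_of_nonneg (hx.trans hy)]
    congr 1
    push_cast
    rw [Real.Gamma_nat_eq_factorial, add_sub_cancel_right, Real.rpow_natCast]
    have : r ^ ((n : ℝ) + 1) = r ^ (n + 1) := by exact_mod_cast Real.rpow_natCast r (n + 1)
    rw [this]
    ring
  have hlim : Filter.Tendsto g Filter.atTop (nhds 0) := by
    have : Filter.Tendsto g Filter.atTop (nhds (-∑ k ∈ Finset.range (n + 1), (0 : ℝ))) := by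
      refine (tendsto_finsetSum _ fun k _ => ?_).neg
      have h1 := (Real.tendsto_pow_mul_exp_neg_atTop_nhds_zero k).comp
        (Filter.tendsto_id.const_mul_atTop hr)
      have h2 := h1.div_const (k.factorial : ℝ)
      rw [zero_div] at h2
      refine h2.congr fun y => ?_
      simp only [Function.comp_apply, id]
      ring
    simpa using this
  have hnn : ∀ y ∈ Ioi x, 0 ≤ r * ((r * y) ^ n / n.factorial * Real.exp (-(r * y))) := by
    intro y hy
    have : 0 ≤ y := hx.trans (le_of_lt hy)
    positivity
  have hint := integrableOn_Ioi_deriv_of_nonneg' (fun y _ => hasDerivAt_erlang_sum r y n) hnn hlim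
  have hval := integral_Ioi_of_hasDerivAt_of_nonneg' (fun y _ => hasDerivAt_erlang_sum r y n)
    hnn hlim
  rw [gammaMeasure, withDensity_apply _ measurableSet_Ici,
    setLIntegral_congr_fun measurableSet_Ici hpdf, setLIntegral_congr Ioi_ae_eq_Ici.symm,
    ← ofReal_integral_eq_lintegral_ofReal hint ((ae_restrict_iff' measurableSet_Ioi).2
      (Filter.Eventually.of_forall hnn)), hval]
  simp

lemma gammaMeasure_Iic_zero (a r : ℝ) : gammaMeasure a r (Iic 0) = 0 := by
  rw [gammaMeasure, withDensity_apply _ measurableSet_Iic, setLIntegral_congr Iio_ae_eq_Iic.symm]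
  exact lintegral_gammaPDF_of_nonpos le_rfl

lemma erlangTail_nonneg (n : ℕ) {r : ℝ} (hr : 0 < r) (z : ℝ≥0∞) : 0 ≤ erlangTail n r z := by
  refine Finset.sum_nonneg fun k _ => ?_
  have : 0 ≤ expNeg r z := by unfold expNeg; split_ifs <;> positivity
  positivity

lemma gammaMeasure_setOf_le_ofReal {n : ℕ} (hn : 0 < n) {r : ℝ} (hr : 0 < r) (z : ℝ≥0∞) :
    gammaMeasure n r {h | z ≤ ENNReal.ofReal h} = ENNReal.ofReal (erlangTail n r z) := by
  by_cases hz : z = ∞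
  · subst hz
    simp [erlangTail, expNeg]
  · have h1 : {h : ℝ | z ≤ ENNReal.ofReal h} =ᵐ[gammaMeasure n r] Ici z.toReal := by
      have h0 : ∀ᵐ h ∂(gammaMeasure n r), 0 < h := by
        rw [ae_iff]
        simp only [not_lt]
        exact gammaMeasure_Iic_zero n r
      filter_upwards [h0] with h hh
      exact propext (ENNReal.le_ofReal_iff_toReal_le hz hh.le)
    rw [measure_congr h1, gammaMeasure_Ici hn hr ENNReal.toReal_nonneg]
    simp [erlangTail, expNeg, hz]

/-- If `H` is Erlang distributed and independent of `Z`, then conditioning on `Z` evaluates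
the probability of `Z ≤ H` as the mean of the Erlang tail at `Z`. -/
lemma measure_le_ofReal_of_indepFun {Ω : Type*} [MeasurableSpace Ω] {P : Measure Ω}
    [IsProbabilityMeasure P] {n : ℕ} (hn : 0 < n) {r : ℝ} (hr : 0 < r) {H : Ω → ℝ} {Z : Ω → ℝ≥0∞}
    (hH : Measurable H) (hZ : Measurable Z) (hlaw : P.map H = gammaMeasure n r)
    (hind : IndepFun Z H P) :
    P {ω | Z ω ≤ ENNReal.ofReal (H ω)} = ∫⁻ ω, ENNReal.ofReal (erlangTail n r (Z ω)) ∂P := by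
  have hS : MeasurableSet {q : ℝ≥0∞ × ℝ | q.1 ≤ ENNReal.ofReal q.2} :=
    measurableSet_le measurable_fst measurable_snd.ennreal_ofReal
  have hG : IsProbabilityMeasure (gammaMeasure n r) :=
    isProbabilityMeasure_gammaMeasure (by exact_mod_cast hn) hr
  have hmap := (indepFun_iff_map_prod_eq_prod_map_map hZ.aemeasurable hH.aemeasurable).1 hind
  have : {ω | Z ω ≤ ENNReal.ofReal (H ω)} =
    (fun ω => (Z ω, H ω)) ⁻¹' {q : ℝ≥0∞ × ℝ | q.1 ≤ ENNReal.ofReal q.2} := rfl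
  rw [this, ← Measure.map_apply (hZ.prodMk hH) hS, hmap, hlaw, Measure.prod_apply hS,
    lintegral_map (measurable_measure_prodMk_left hS) hZ]
  refine lintegral_congr fun ω => ?_
  exact gammaMeasure_setOf_le_ofReal hn hr (Z ω)

/-! ### Radial null sets -/

lemma measure_norm_mem_eq_zero {E : Type*} [NormedAddCommGroup E] [NormedSpace ℝ E]
    [FiniteDimensional ℝ E] [Nontrivial E] [MeasurableSpace E] [BorelSpace E] (μ : Measure E)
    [μ.IsAddHaarMeasure] {S : Set ℝ} (hS : MeasurableSet S) (h0 : volume (S ∩ Ioi 0) = 0) :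
    μ {x | ‖x‖ ∈ S} = 0 := by
  set f : ℝ → ℝ := S.indicator 1 with hf
  have hz : (fun y : ℝ => y ^ (Module.finrank ℝ E - 1) • f y) =ᵐ[volume.restrict (Ioi 0)] 0 := by
    have : ∀ᵐ y ∂(volume.restrict (Ioi (0 : ℝ))), y ∉ S := by
      rw [ae_iff]
      simpa [Measure.restrict_apply hS] using h0
    filter_upwards [this] with y hy
    simp [hf, hy]
  have hint : Integrable (fun x => f ‖x‖) μ := by
    rw [integrable_fun_norm_addHaar μ (f := f)]
    exact (integrable_zero _ _ _).congr hz.symm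
  have hval : ∫ x, f ‖x‖ ∂μ = 0 := by
    rw [integral_fun_norm_addHaar μ f, integral_congr_ae hz]
    simp
  rw [integral_eq_zero_iff_of_nonneg (fun x => by
    simp only [hf]; exact indicator_nonneg (fun _ _ => zero_le_one) _) hint] at hval
  have : μ {x | ¬ (f ‖x‖ = 0)} = 0 := hval
  convert this using 3 with x
  simp [hf]

/-- The distance `√(‖x‖² + h²)` to a point at height `h` above the origin pulls null sets back to
null sets: on `(|h|, ∞)` the radius is a differentiable function of the distance. -/
lemma volume_sqrt_norm_sq_add_mem_eq_zero {S : Set ℝ} (hS : MeasurableSet S) (h0 : volume S = 0)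
    (h : ℝ) : (volume : Measure Plane) {x | Real.sqrt (‖x‖ ^ 2 + h ^ 2) ∈ S} = 0 := by
  refine measure_norm_mem_eq_zero (volume : Measure Plane)
    (S := (fun y : ℝ => Real.sqrt (y ^ 2 + h ^ 2)) ⁻¹' S) (hS.preimage (by fun_prop)) ?_
  have hnull : volume ((fun y : ℝ => Real.sqrt (y ^ 2 - h ^ 2)) '' (S ∩ Ioi |h|)) = 0 := by
    refine addHaar_image_eq_zero_of_differentiableOn_of_addHaar_eq_zero volume ?_
      (measure_mono_null inter_subset_left h0)
    intro y hy
    have hy2 : h ^ 2 < y ^ 2 :=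
      sq_lt_sq' (by linarith [neg_abs_le h, hy.2.out]) (lt_of_le_of_lt (le_abs_self h) hy.2)
    refine DifferentiableAt.differentiableWithinAt ?_
    exact DifferentiableAt.sqrt (by fun_prop) (by linarith)
  refine measure_mono_null ?_ hnull
  rintro y ⟨hyS, hy⟩
  have hy : 0 < y := hy
  refine ⟨Real.sqrt (y ^ 2 + h ^ 2), ⟨hyS, ?_⟩, ?_⟩
  · rw [mem_Ioi, ← Real.sqrt_sq_eq_abs]
    exact Real.sqrt_lt_sqrt (sq_nonneg h) (by nlinarith)
  · simp only
    rw [Real.sq_sqrt (by positivity), add_sub_cancel_right, Real.sqrt_sq hy.le]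

end VHetNet

/-! ### Measurability of the network -/

namespace VHetNet

instance : Finite Tier :=
  Finite.of_injective (fun ν : Tier => match ν with | .L => (0 : Fin 3) | .N => 1 | .A => 2)
    (by intro x y; cases x <;> cases y <;> simp)

lemma measurable_countable_choice {Ω ι β : Type*} [Countable ι] {𝒢 : MeasurableSpace Ω}
    [MeasurableSpace β] {c : Ω → ι} (hc : ∀ i, MeasurableSet[𝒢] {ω | c ω = i}) {f : ι → Ω → β}
    (hf : ∀ i, Measurable[𝒢] (f i)) : Measurable[𝒢] fun ω => f (c ω) ω := by
  intro S hS
  have : (fun ω => f (c ω) ω) ⁻¹' S = ⋃ i, {ω | c ω = i} ∩ f i ⁻¹' S := by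
    ext ω
    simp
  rw [this]
  exact MeasurableSet.iUnion fun i => (hc i).inter (hf i hS)

namespace Params

variable (p : Params)

lemma hUT_pos : 0 < p.hUT := sub_pos.2 p.hT_lt_hU

lemma hUA_pos : 0 < p.hUA := sub_pos.2 p.hU_lt_hA

lemma mu_pos (ν : Tier) : 0 < p.mu ν := by
  have := p.PT_pos
  have := p.PA_pos
  have := p.gsT_pos
  have := p.GmA_pos
  have := p.eta_pos ν
  cases ν <;> simp only [mu] <;> positivity

lemma d_pos : 0 < p.d := Real.sqrt_pos.2 (by have := p.rD_pos; positivity)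

lemma measurable_PL : Measurable p.PL := by
  unfold PL elevation
  have : Measurable fun z : ℝ => if z = 0 then Real.pi / 2 else Real.arctan (p.hUT / z) :=
    Measurable.ite (measurableSet_singleton 0) measurable_const (by fun_prop)
  fun_prop

lemma measurableSet_servRange (ν : Tier) : MeasurableSet (p.servRange ν) := by
  cases ν <;> exact measurableSet_Icc

lemma servRange_subset_Ioi (ν : Tier) : p.servRange ν ⊆ Ioi 0 := by
  intro r hr
  cases ν
  · exact p.hUT_pos.trans_le hr.1
  · exact p.hUT_pos.trans_le hr.1
  · exact p.hUA_pos.trans_le hr.1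

end Params

namespace Network

-- `𝒢` comes before `mΩ`, so that instance search finds `mΩ`.
variable {p : Params} {Ω : Type*} {𝒢 : MeasurableSpace Ω} [mΩ : MeasurableSpace Ω] {P : Measure Ω}
  (W : Network p P)

variable (𝒢) in
/-- The positions of all base stations and the line-of-sight marks are measurable with respect to
`𝒢`; association with a base station is then an event of `𝒢`. -/
structure GeometryMeasurable : Prop where
  X : ∀ j, Measurable[𝒢] (W.X j)
  U : ∀ j, Measurable[𝒢] (W.U j)
  Y : ∀ i, Measurable[𝒢] (W.Y i)

lemma geometryMeasurable : W.GeometryMeasurable mΩ :=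
  ⟨W.X_poisson.measurable, W.U_meas, W.Y_meas⟩

variable {W}

lemma GeometryMeasurable.tier (h : W.GeometryMeasurable 𝒢) (b : BS p) (ν : Tier) :
    MeasurableSet[𝒢] {ω | W.tier b ω = ν} := by
  rcases b with j | i
  · have hS : MeasurableSet[𝒢] {ω | W.U j ω ≤ p.PL ‖W.X j ω‖} :=
      measurableSet_le (h.U j) (p.measurable_PL.comp (measurable_norm.comp (h.X j)))
    cases ν
    · convert hS using 3 with ω
      by_cases hω : W.U j ω ≤ p.PL ‖W.X j ω‖ <;> simp [Network.tier, hω]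
    · convert hS.compl using 1
      ext ω
      by_cases hω : W.U j ω ≤ p.PL ‖W.X j ω‖ <;> simp [Network.tier, hω, not_le.1]
    · convert MeasurableSet.empty using 1
      ext ω
      by_cases hω : W.U j ω ≤ p.PL ‖W.X j ω‖ <;> simp [Network.tier, hω]
  · exact MeasurableSet.const (Tier.A = ν)

lemma GeometryMeasurable.dist (h : W.GeometryMeasurable 𝒢) (b : BS p) :
    Measurable[𝒢] (W.dist b) := by
  have hm : ∀ a : ℝ, Measurable fun x : Plane => Real.sqrt (‖x‖ ^ 2 + a ^ 2) := by fun_prop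
  rcases b with j | i
  · exact (hm p.hUT).comp (h.X j)
  · exact (hm p.hUA).comp (h.Y i)

lemma GeometryMeasurable.meanPower (h : W.GeometryMeasurable 𝒢) (b : BS p) :
    Measurable[𝒢] (W.meanPower b) :=
  measurable_countable_choice (c := W.tier b)
    (f := fun ν ω => p.mu ν * W.dist b ω ^ (-p.alpha ν)) (h.tier b)
    fun _ => ((h.dist b).pow_const _).const_mul _

lemma GeometryMeasurable.isStrongest (h : W.GeometryMeasurable 𝒢) (b : BS p) :
    MeasurableSet[𝒢] {ω | W.IsStrongest b ω} := by
  simp only [IsStrongest, ofPred_forall]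
  exact MeasurableSet.iInter fun b' => measurableSet_le (h.meanPower b') (h.meanPower b)

lemma GeometryMeasurable.isServing (h : W.GeometryMeasurable 𝒢) (b : BS p) :
    MeasurableSet[𝒢] {ω | W.IsServing b ω} := by
  simp only [IsServing, ofPred_and, ofPred_forall]
  refine (h.isStrongest b).inter (MeasurableSet.iInter fun b' => ?_)
  by_cases hb : Encodable.encode b ≤ Encodable.encode b'
  · simp [hb]
  · simp only [hb, imp_false]
    exact (h.isStrongest b').compl

lemma GeometryMeasurable.fading_inl (h : W.GeometryMeasurable 𝒢) {j : ℕ}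
    (hL : Measurable[𝒢] (W.HL j)) (hN : Measurable[𝒢] (W.HN j)) :
    Measurable[𝒢] (W.fading (.inl j)) :=
  measurable_countable_choice (c := W.tier (.inl j))
    (f := fun ν ω => match ν with
      | .L => W.HL j ω
      | _ => W.HN j ω) (h.tier _) fun ν => by cases ν <;> assumption

lemma GeometryMeasurable.signal (h : W.GeometryMeasurable 𝒢) {b : BS p}
    (hf : Measurable[𝒢] (W.fading b)) :
    Measurable[𝒢] (W.signal b) :=
  measurable_countable_choice (c := W.tier b)
    (f := fun ν ω => p.mu ν * W.fading b ω * W.dist b ω ^ (-p.alpha ν)) (h.tier b)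
    fun _ => (hf.const_mul _).mul ((h.dist b).pow_const _)

lemma GeometryMeasurable.interfPower_inl (h : W.GeometryMeasurable 𝒢) {j : ℕ}
    (hL : Measurable[𝒢] (W.HL j)) (hN : Measurable[𝒢] (W.HN j)) :
    Measurable[𝒢] (W.interfPower (.inl j)) :=
  h.signal (h.fading_inl hL hN)

lemma GeometryMeasurable.interfPower_inr (h : W.GeometryMeasurable 𝒢) {i : Fin p.numA}
    (hH : Measurable[𝒢] (W.HA i)) (hG : Measurable[𝒢] (W.G i)) :
    Measurable[𝒢] (W.interfPower (.inr i)) :=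
  ((((hG.const_mul p.PA).mul_const (p.eta .A)).mul hH).mul ((h.dist (.inr i)).pow_const _))

variable (W)

lemma measurable_dist (b : BS p) : Measurable (W.dist b) := W.geometryMeasurable.dist b

lemma measurable_signal (b : BS p) : Measurable (W.signal b) := by
  refine W.geometryMeasurable.signal ?_
  rcases b with j | i
  · exact W.geometryMeasurable.fading_inl (W.HL_meas j) (W.HN_meas j)
  · exact W.HA_meas i

lemma measurable_interfPower (b : BS p) : Measurable (W.interfPower b) := by
  rcases b with j | i
  · exact W.geometryMeasurable.interfPower_inl (W.HL_meas j) (W.HN_meas j)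
  · exact W.geometryMeasurable.interfPower_inr (W.HA_meas i) (W.G_meas i)

variable {W} in
lemma IsServing.unique {b b' : BS p} {ω : Ω} (h : W.IsServing b ω) (h' : W.IsServing b' ω) :
    b = b' :=
  Encodable.encode_injective (le_antisymm (h.2 b' h'.1) (h'.2 b h.1))

variable {W} in
lemma IsServing.serving_eq {b : BS p} {ω : Ω} (h : W.IsServing b ω) : W.serving ω = b := by
  have hex : ∃ b, W.IsServing b ω := ⟨b, h⟩
  rw [serving, dif_pos hex]
  exact hex.choose_spec.unique h

lemma measurableSet_serving_eq (b : BS p) : MeasurableSet {ω | W.serving ω = b} := by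
  have hS := W.geometryMeasurable.isServing
  have : {ω | W.serving ω = b} =
      {ω | W.IsServing b ω} ∪ ((⋂ b', {ω | W.IsServing b' ω}ᶜ) ∩ {_ω | Sum.inl 0 = b}) := by
    ext ω
    simp only [mem_ofPred_eq, mem_union, mem_inter_iff, mem_iInter, mem_compl_iff]
    by_cases hex : ∃ b, W.IsServing b ω
    · obtain ⟨b₀, hb₀⟩ := hex
      rw [hb₀.serving_eq]
      refine ⟨fun h => .inl (h ▸ hb₀), ?_⟩
      rintro (h | h)
      · exact hb₀.unique h
      · exact absurd hb₀ (h.1 b₀)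
    · rw [serving, dif_neg hex]
      refine ⟨fun h => .inr ⟨fun b' hb' => hex ⟨b', hb'⟩, h⟩, ?_⟩
      rintro (h | h)
      · exact absurd ⟨b, h⟩ hex
      · exact h.2
  rw [this]
  exact (hS b).union ((MeasurableSet.iInter fun b' => (hS b').compl).inter (MeasurableSet.const _))

lemma measurable_servDist : Measurable W.servDist :=
  measurable_countable_choice W.measurableSet_serving_eq W.measurable_dist

open Classical in
/-- Aggregate interference power when the base station `b₀` serves. -/
noncomputable def interferenceAt (pol : Policy) (b₀ : BS p) (ω : Ω) : ℝ≥0∞ :=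
  ∑' b : BS p, if b ≠ b₀ ∧ Shares pol b₀ b then ENNReal.ofReal (W.interfPower b ω) else 0

/-- The interference does not involve the gains of the serving base station. -/
lemma measurable_interferenceAt (pol : Policy) (b₀ : BS p)
    (h : ∀ b, b ≠ b₀ → Measurable[𝒢] (W.interfPower b)) :
    Measurable[𝒢] (W.interferenceAt pol b₀) := by
  refine @Measurable.tsum Ω _ _ 𝒢 _ _ _ _ _ _ _ _ _ _ _ _ fun b => ?_
  by_cases hb : b ≠ b₀ ∧ Shares pol b₀ b
  · simp only [if_pos hb]
    exact (h b hb.1).ennreal_ofReal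
  · simp only [if_neg hb]
    exact measurable_const

lemma measurable_interference (pol : Policy) : Measurable (W.interference pol) :=
  measurable_countable_choice (f := W.interferenceAt pol) W.measurableSet_serving_eq
    fun b => W.measurable_interferenceAt pol b fun b' _ => W.measurable_interfPower b'

lemma measurable_interfNoise (pol : Policy) : Measurable (W.interfNoise pol) :=
  (W.measurable_interference pol).add_const _

lemma measurable_sinr (pol : Policy) : Measurable (W.sinr pol) :=
  Measurable.div (measurable_countable_choice W.measurableSet_serving_eq
    W.measurable_signal).ennreal_ofReal (W.measurable_interfNoise pol)

/-- The event that `b` serves the user as a base station of tier `ν`. -/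
def servesInTier (ν : Tier) (b : BS p) : Set Ω := {ω | W.IsServing b ω ∧ W.tier b ω = ν}

variable {W} in
lemma GeometryMeasurable.servesInTier (h : W.GeometryMeasurable 𝒢) (ν : Tier) (b : BS p) :
    MeasurableSet[𝒢] (W.servesInTier ν b) :=
  (h.isServing b).inter (h.tier b ν)

lemma assocEvent_eq_iUnion (ν : Tier) : W.assocEvent ν = ⋃ b, W.servesInTier ν b := by
  ext ω
  simp [assocEvent, servesInTier]

lemma pairwise_disjoint_servesInTier (ν : Tier) :
    Pairwise (Function.onFun Disjoint (W.servesInTier ν)) := fun _ _ hbb' =>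
  Set.disjoint_left.2 fun _ h h' => hbb' (h.1.unique h'.1)

lemma measurableSet_assocEvent (ν : Tier) : MeasurableSet (W.assocEvent ν) := by
  rw [assocEvent_eq_iUnion]
  exact MeasurableSet.iUnion (W.geometryMeasurable.servesInTier ν)

lemma dist_pos (b : BS p) (ω : Ω) : 0 < W.dist b ω := by
  rcases b with j | i
  · have := p.hUT_pos
    exact Real.sqrt_pos.2 (by positivity)
  · have := p.hUA_pos
    exact Real.sqrt_pos.2 (by positivity)

/-! ### The law of the serving distance -/

/-- The void probabilities of the Poisson process make the law of each of its points absolutely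
continuous, whatever the enumeration. -/
lemma measure_X_mem_eq_zero [IsProbabilityMeasure P] (j : ℕ) {B : Set Plane}
    (hB : MeasurableSet B) (h0 : volume B = 0) : P {ω | W.X j ω ∈ B} = 0 := by
  have hΛ : (ENNReal.ofReal p.lamT • (volume : Measure Plane)) B = 0 := by simp [h0]
  have h1 := W.X_poisson.count_law B hB (by simp [hΛ]) 0
  have hset : {ω | count W.X B ω = ((0 : ℕ) : ℕ∞)} = ⋂ i, {ω | W.X i ω ∈ B}ᶜ := by
    ext ω
    simp [count, Set.eq_empty_iff_forall_notMem]
  rw [hset, hΛ] at h1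
  have hm : MeasurableSet (⋂ i, {ω | W.X i ω ∈ B}ᶜ) :=
    MeasurableSet.iInter fun i => (W.X_poisson.measurable i hB).compl
  have h2 : P (⋂ i, {ω | W.X i ω ∈ B}ᶜ)ᶜ = 0 := by
    rw [prob_compl_eq_zero_iff hm, h1]
    simp
  refine measure_mono_null (fun ω hω => ?_) h2
  simp only [mem_compl_iff, mem_iInter, not_forall, not_not]
  exact ⟨j, hω⟩

lemma measure_dist_mem_eq_zero [IsProbabilityMeasure P] (b : BS p) {S : Set ℝ}
    (hS : MeasurableSet S) (h0 : volume S = 0) : P {ω | W.dist b ω ∈ S} = 0 := by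
  have key : ∀ (h : ℝ) (Z : Ω → Plane),
      (∀ B, MeasurableSet B → volume B = 0 → P (Z ⁻¹' B) = 0) →
      P {ω | Real.sqrt (‖Z ω‖ ^ 2 + h ^ 2) ∈ S} = 0 := fun h Z hac =>
    hac _ (hS.preimage (f := fun x : Plane => Real.sqrt (‖x‖ ^ 2 + h ^ 2)) (by fun_prop))
      (volume_sqrt_norm_sq_add_mem_eq_zero hS h0 h)
  rcases b with j | i
  · exact key p.hUT (W.X j) fun B => W.measure_X_mem_eq_zero j
  · refine key p.hUA (W.Y i) fun B hB h => ?_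
    rw [← Measure.map_apply (W.Y_meas i) hB, W.Y_law i]
    exact cond_absolutelyContinuous h

lemma servDistLaw_absolutelyContinuous [IsProbabilityMeasure P] (ν : Tier) :
    W.servDistLaw ν ≪ volume := by
  refine Measure.AbsolutelyContinuous.mk fun S hS h0 => ?_
  rw [servDistLaw, Measure.map_apply W.measurable_servDist hS]
  have hsub : W.servDist ⁻¹' S ⊆ ⋃ b, {ω | W.dist b ω ∈ S} := by
    intro ω hω
    rw [mem_preimage, servDist] at hω
    exact mem_iUnion.2 ⟨W.serving ω, hω⟩
  have hnull : P (⋃ b, {ω | W.dist b ω ∈ S}) = 0 :=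
    measure_iUnion_null fun b => W.measure_dist_mem_eq_zero b hS h0
  exact cond_absolutelyContinuous (measure_mono_null hsub hnull)

lemma ae_norm_Y_le (i : Fin p.numA) : ∀ᵐ ω ∂P, ‖W.Y i ω‖ ≤ p.rD := by
  have h : ∀ᵐ y ∂(P.map (W.Y i)), ‖y‖ ≤ p.rD := by
    rw [W.Y_law i]
    filter_upwards [ae_cond_mem (μ := (volume : Measure Plane))
      (measurableSet_closedBall (x := (0 : Plane)) (ε := p.rD))] with y hy
    simpa using hy
  exact ae_of_ae_map (W.Y_meas i).aemeasurable h

lemma dist_inr_le_d {i : Fin p.numA} {ω : Ω} (h : ‖W.Y i ω‖ ≤ p.rD) :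
    W.dist (.inr i) ω ≤ p.d := by
  refine Real.sqrt_le_sqrt ?_
  gcongr

/-- A serving base station that is no weaker than an aerial one within reach is not farther
than `ζ`. -/
lemma dist_le_zetaA {b : BS p} {ω : Ω} {i : Fin p.numA} (hY : ‖W.Y i ω‖ ≤ p.rD)
    (hb : W.IsStrongest b ω) : W.dist b ω ≤ p.zetaA (W.tier b ω) p.d := by
  set ν := W.tier b ω
  have h1 : p.mu .A * W.dist (.inr i) ω ^ (-p.alpha .A) ≤ p.mu ν * W.dist b ω ^ (-p.alpha ν) :=
    hb (.inr i)
  have hr := W.dist_pos b ω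
  have hi := W.dist_pos (.inr i) ω
  have hA := p.mu_pos .A
  have hν := p.mu_pos ν
  have hd := p.d_pos
  have h2 : p.mu .A * p.d ^ (-p.alpha .A) ≤ p.mu .A * W.dist (.inr i) ω ^ (-p.alpha .A) := by
    gcongr ?_ * ?_
    exact Real.rpow_le_rpow_of_nonpos hi (W.dist_inr_le_d hY) (by linarith [p.alpha_pos .A])
  have h3 := h2.trans h1
  rw [Real.rpow_neg hd.le, Real.rpow_neg hr.le, ← div_eq_mul_inv, ← div_eq_mul_inv,
    div_le_div_iff₀ (by positivity) (by positivity)] at h3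
  have h4 : W.dist b ω ^ p.alpha ν ≤ p.mu ν * p.d ^ p.alpha .A / p.mu .A := by
    rw [le_div_iff₀ hA]
    linarith
  calc W.dist b ω = (W.dist b ω ^ p.alpha ν) ^ (1 / p.alpha ν) := by
        rw [one_div, Real.rpow_rpow_inv hr.le (p.alpha_pos ν).ne']
    _ ≤ _ := Real.rpow_le_rpow (by positivity) h4 (one_div_nonneg.2 (p.alpha_pos ν).le)

lemma hUT_le_dist (j : ℕ) (ω : Ω) : p.hUT ≤ W.dist (.inl j) ω :=
  Real.le_sqrt_of_sq_le (by nlinarith [sq_nonneg ‖W.X j ω‖])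

lemma hUA_le_dist (i : Fin p.numA) (ω : Ω) : p.hUA ≤ W.dist (.inr i) ω :=
  Real.le_sqrt_of_sq_le (by nlinarith [sq_nonneg ‖W.Y i ω‖])

lemma tier_inl_ne (j : ℕ) (ω : Ω) : W.tier (.inl j) ω ≠ .A := by
  simp only [tier]
  split_ifs <;> simp

lemma dist_mem_servRange {ν : Tier} {b : BS p} {ω : Ω} (hY : ∀ i, ‖W.Y i ω‖ ≤ p.rD)
    (hb : ω ∈ W.servesInTier ν b) : W.dist b ω ∈ p.servRange ν := by
  obtain ⟨hb, rfl⟩ := hb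
  rcases b with j | i
  · have h1 := W.hUT_le_dist j ω
    have h2 := W.dist_le_zetaA (hY ⟨0, p.numA_pos⟩) hb.1
    have h3 := W.tier_inl_ne j ω
    revert h2 h3
    generalize W.tier (.inl j) ω = ν
    intro h2 h3
    cases ν
    · exact ⟨h1, h2⟩
    · exact ⟨h1, h2.trans (le_max_right _ _)⟩
    · exact absurd rfl h3
  · exact ⟨W.hUA_le_dist i ω, W.dist_inr_le_d (hY i)⟩

lemma ae_servDist_mem_servRange (ν : Tier) :
    ∀ᵐ ω ∂(P[|W.assocEvent ν]), W.servDist ω ∈ p.servRange ν := by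
  have hY : ∀ᵐ ω ∂(P[|W.assocEvent ν]), ∀ i, ‖W.Y i ω‖ ≤ p.rD :=
    cond_absolutelyContinuous.ae_le (ae_all_iff.2 W.ae_norm_Y_le)
  filter_upwards [hY, ae_cond_mem (W.measurableSet_assocEvent ν)] with ω hω hE
  obtain ⟨b, hb⟩ := hE
  rw [servDist, hb.1.serving_eq]
  exact W.dist_mem_servRange hω hb

lemma servDistLaw_compl_servRange (ν : Tier) : W.servDistLaw ν (p.servRange ν)ᶜ = 0 := by
  rw [servDistLaw, Measure.map_apply W.measurable_servDist (p.measurableSet_servRange ν).compl]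
  exact W.ae_servDist_mem_servRange ν

end Network

end VHetNet

/-! ### Averaging over the fading of the serving base station -/

namespace VHetNet

namespace Network

variable {p : Params} {Ω : Type*} {𝒢 : MeasurableSpace Ω} [mΩ : MeasurableSpace Ω] {P : Measure Ω}
  (W : Network p P)

/-- Threshold that the fading gain of a base station of tier `ν` at distance `r` has to reach for
coverage when interference plus noise is `v`. -/
noncomputable def fadingThreshold (p : Params) (ν : Tier) (T r : ℝ) (v : ℝ≥0∞) : ℝ≥0∞ :=
  ENNReal.ofReal (T * r ^ p.alpha ν / p.mu ν) * v

lemma measurable_fadingThreshold {Ω : Type*} {𝒢 : MeasurableSpace Ω} (p : Params) (ν : Tier)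
    (T : ℝ) {R : Ω → ℝ} {V : Ω → ℝ≥0∞} (hR : Measurable R) (hV : Measurable V) :
    Measurable fun ω => fadingThreshold p ν T (R ω) (V ω) := by
  unfold fadingThreshold
  exact (((hR.pow_const _).const_mul T).div_const _).ennreal_ofReal.mul hV

lemma ofReal_le_div_iff_fadingThreshold_le (ν : Tier) {T r h : ℝ} (hT : 0 < T) (hr : 0 < r)
    (hh : 0 < h) (v : ℝ≥0∞) :
    ENNReal.ofReal T ≤ ENNReal.ofReal (p.mu ν * h * r ^ (-p.alpha ν)) / v ↔
      fadingThreshold p ν T r v ≤ ENNReal.ofReal h := by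
  have hμ := p.mu_pos ν
  have hc : 0 < p.mu ν * r ^ (-p.alpha ν) := by positivity
  have hsig : 0 < p.mu ν * h * r ^ (-p.alpha ν) := by positivity
  have hpow : r ^ (-p.alpha ν) * r ^ p.alpha ν = 1 := by
    rw [← Real.rpow_add hr, neg_add_cancel, Real.rpow_zero]
  have h1 : ENNReal.ofReal T * v = ENNReal.ofReal (p.mu ν * r ^ (-p.alpha ν)) *
      fadingThreshold p ν T r v := by
    rw [fadingThreshold, ← mul_assoc, ← ENNReal.ofReal_mul hc.le]
    congr 2
    calc T = T * (r ^ (-p.alpha ν) * r ^ p.alpha ν) := by rw [hpow, mul_one]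
      _ = _ := by field_simp
  have h2 : ENNReal.ofReal (p.mu ν * h * r ^ (-p.alpha ν)) =
      ENNReal.ofReal (p.mu ν * r ^ (-p.alpha ν)) * ENNReal.ofReal h := by
    rw [← ENNReal.ofReal_mul hc.le]
    congr 1
    ring
  rw [ENNReal.le_div_iff_mul_le (.inr (ENNReal.ofReal_pos.2 hsig).ne') (.inr ENNReal.ofReal_ne_top),
    h1, h2, ENNReal.mul_le_mul_iff_right (ENNReal.ofReal_pos.2 hc).ne' ENNReal.ofReal_ne_top]

/-- Coverage while `b` serves: as soon as the fading gain `H` of `b` is independent of a σ-algebra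
`𝒢` that determines the association and all interfering powers, it can be averaged out. -/
lemma measure_servesInTier_inter_covered [IsProbabilityMeasure P] (pol : Policy) {ν : Tier} {M : ℕ}
    (hM : p.m ν = M) {T : ℝ} (hT : 0 < T) (b : BS p) (h𝒢 : 𝒢 ≤ mΩ) (hgeo : W.GeometryMeasurable 𝒢)
    (hint : ∀ b', b' ≠ b → Measurable[𝒢] (W.interfPower b')) {H : Ω → ℝ} (hH : Measurable H)
    (hlaw : P.map H = gammaMeasure (p.m ν) (p.m ν))
    (hind : Indep 𝒢 (MeasurableSpace.comap H inferInstance) P)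
    (hfade : ∀ ω ∈ W.servesInTier ν b, W.fading b ω = H ω) :
    P (W.servesInTier ν b ∩ {ω | ENNReal.ofReal T ≤ W.sinr pol ω}) =
      ∫⁻ ω in W.servesInTier ν b, ENNReal.ofReal
        (erlangTail M M (fadingThreshold p ν T (W.servDist ω) (W.interfNoise pol ω))) ∂P := by
  classical
  have hM0 : (0 : ℝ) < M := hM ▸ p.m_pos ν
  rw [hM] at hlaw
  set A := W.servesInTier ν b with hA
  have hAm : MeasurableSet[𝒢] A := hgeo.servesInTier ν b
  -- Outside of `A` the value `∞` makes the threshold unreachable.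
  set Z : Ω → ℝ≥0∞ := fun ω => if ω ∈ A then fadingThreshold p ν T (W.dist b ω)
    (W.interferenceAt pol b ω + ENNReal.ofReal p.sigma2) else ∞ with hZ
  have hadd : Measurable fun v : ℝ≥0∞ => v + ENNReal.ofReal p.sigma2 := by fun_prop
  have hZm : Measurable[𝒢] Z := by
    refine Measurable.ite hAm ?_ measurable_const
    refine measurable_fadingThreshold p ν T (hgeo.dist b) ?_
    exact hadd.comp (W.measurable_interferenceAt pol b hint)
  have hZA : ∀ ω ∈ A, Z ω = fadingThreshold p ν T (W.servDist ω) (W.interfNoise pol ω) := by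
    intro ω hω
    have hs : W.serving ω = b := hω.1.serving_eq
    simp only [hZ, if_pos hω, servDist, hs, interfNoise]
    rw [show W.interference pol ω = W.interferenceAt pol (W.serving ω) ω from rfl, hs]
  have hindZ : IndepFun Z H P := indep_of_indep_of_le_left hind hZm.comap_le
  have hpos : ∀ᵐ ω ∂P, 0 < H ω := by
    refine ae_of_ae_map hH.aemeasurable (p := fun x => 0 < x) ?_
    rw [hlaw, ae_iff]
    simp only [not_lt]
    exact gammaMeasure_Iic_zero M M
  have hset : (A ∩ {ω | ENNReal.ofReal T ≤ W.sinr pol ω} : Set Ω) =ᵐ[P]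
      {ω | Z ω ≤ ENNReal.ofReal (H ω)} := by
    filter_upwards [hpos] with ω hω
    refine propext ?_
    change (ω ∈ A ∧ ENNReal.ofReal T ≤ W.sinr pol ω) ↔ Z ω ≤ ENNReal.ofReal (H ω)
    by_cases hωA : ω ∈ A
    · have hs : W.serving ω = b := hωA.1.serving_eq
      rw [hZA ω hωA, sinr, signal, hs, hωA.2, hfade ω hωA, servDist, hs,
        ofReal_le_div_iff_fadingThreshold_le ν hT (W.dist_pos b ω) hω]
      simp [hωA]
    · simp [hZ, hωA]
  rw [measure_congr hset, measure_le_ofReal_of_indepFun (by exact_mod_cast hM0) hM0 hH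
    (hZm.mono h𝒢 le_rfl) hlaw hindZ, ← lintegral_indicator (h𝒢 _ hAm)]
  refine lintegral_congr fun ω => ?_
  by_cases hωA : ω ∈ A
  · rw [indicator_of_mem hωA, hZA ω hωA]
  · simp [hZ, hωA, erlangTail, expNeg]

/-- The σ-algebra of one of the independent sources of randomness. -/
@[reducible]
def sourceSigma : Source p.numA → MeasurableSpace Ω
  | .sites => MeasurableSpace.comap (fun ω j => W.X j ω) inferInstance
  | .los j => MeasurableSpace.comap (W.U j) inferInstance
  | .fadeL j => MeasurableSpace.comap (W.HL j) inferInstance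
  | .fadeN j => MeasurableSpace.comap (W.HN j) inferInstance
  | .pos i => MeasurableSpace.comap (W.Y i) inferInstance
  | .fadeA i => MeasurableSpace.comap (W.HA i) inferInstance
  | .gain i => MeasurableSpace.comap (W.G i) inferInstance

lemma iIndep_sourceSigma : iIndep W.sourceSigma P := by
  convert W.indep using 2 with s

lemma sourceSigma_le (s : Source p.numA) : W.sourceSigma s ≤ mΩ := by
  cases s
  · exact (measurable_pi_lambda _ W.X_poisson.measurable).comap_le
  · exact (W.U_meas _).comap_le
  · exact (W.HL_meas _).comap_le
  · exact (W.HN_meas _).comap_le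
  · exact (W.Y_meas _).comap_le
  · exact (W.HA_meas _).comap_le
  · exact (W.G_meas _).comap_le

/-- The σ-algebra of all sources of randomness but one. -/
@[reducible]
def otherSigma (s : Source p.numA) : MeasurableSpace Ω :=
  ⨆ s' ∈ ({s}ᶜ : Set (Source p.numA)), W.sourceSigma s'

lemma otherSigma_le (s : Source p.numA) : W.otherSigma s ≤ mΩ :=
  iSup₂_le fun s' _ => W.sourceSigma_le s'

lemma indep_otherSigma (s : Source p.numA) : Indep (W.otherSigma s) (W.sourceSigma s) P := by
  have h := indep_iSup_of_disjoint W.sourceSigma_le W.iIndep_sourceSigma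
    (disjoint_compl_left (a := ({s} : Set (Source p.numA))))
  simpa only [otherSigma, mem_singleton_iff, iSup_iSup_eq_left] using h

lemma measurable_otherSigma {β : Type*} [MeasurableSpace β] {s s' : Source p.numA} (h : s' ≠ s)
    {f : Ω → β} (hf : Measurable[W.sourceSigma s'] f) : Measurable[W.otherSigma s] f :=
  hf.mono (le_iSup₂_of_le s' h le_rfl) le_rfl

lemma geometryMeasurable_otherSigma {s : Source p.numA} (h1 : s ≠ .sites) (h2 : ∀ j, s ≠ .los j)
    (h3 : ∀ i, s ≠ .pos i) : W.GeometryMeasurable (W.otherSigma s) where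
  X j := W.measurable_otherSigma h1.symm
    ((measurable_pi_apply j).comp (comap_measurable fun ω j => W.X j ω))
  U j := W.measurable_otherSigma (h2 j).symm (comap_measurable (W.U j))
  Y i := W.measurable_otherSigma (h3 i).symm (comap_measurable (W.Y i))

lemma measurable_interfPower_otherSigma {s : Source p.numA} {b : BS p}
    (hgeo : W.GeometryMeasurable (W.otherSigma s))
    (hL : ∀ j, b = .inl j → s ≠ .fadeL j ∧ s ≠ .fadeN j)
    (hA : ∀ i, b = .inr i → s ≠ .fadeA i ∧ s ≠ .gain i) :
    Measurable[W.otherSigma s] (W.interfPower b) := by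
  rcases b with j | i
  · exact hgeo.interfPower_inl
      (W.measurable_otherSigma (hL j rfl).1.symm (comap_measurable (W.HL j)))
      (W.measurable_otherSigma (hL j rfl).2.symm (comap_measurable (W.HN j)))
  · exact hgeo.interfPower_inr
      (W.measurable_otherSigma (hA i rfl).1.symm (comap_measurable (W.HA i)))
      (W.measurable_otherSigma (hA i rfl).2.symm (comap_measurable (W.G i)))

lemma measure_servesInTier_inter_covered_eq [IsProbabilityMeasure P] (pol : Policy) {ν : Tier}
    {M : ℕ} (hM : p.m ν = M) {T : ℝ} (hT : 0 < T) (b : BS p) :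
    P (W.servesInTier ν b ∩ {ω | ENNReal.ofReal T ≤ W.sinr pol ω}) =
      ∫⁻ ω in W.servesInTier ν b, ENNReal.ofReal
        (erlangTail M M (fadingThreshold p ν T (W.servDist ω) (W.interfNoise pol ω))) ∂P := by
  have hempty : W.servesInTier ν b = ∅ →
      P (W.servesInTier ν b ∩ {ω | ENNReal.ofReal T ≤ W.sinr pol ω}) =
        ∫⁻ ω in W.servesInTier ν b, ENNReal.ofReal
          (erlangTail M M (fadingThreshold p ν T (W.servDist ω) (W.interfNoise pol ω))) ∂P := by
    intro h
    simp [h]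
  rcases b with j | i
  · cases ν
    · have hgeo : W.GeometryMeasurable (W.otherSigma (.fadeL j)) :=
        W.geometryMeasurable_otherSigma (by simp) (by simp) (by simp)
      refine W.measure_servesInTier_inter_covered pol hM hT (.inl j) (W.otherSigma_le (.fadeL j))
        hgeo (fun b' hb' => W.measurable_interfPower_otherSigma hgeo ?_ (by simp)) (W.HL_meas j)
        (W.HL_law j) (W.indep_otherSigma (.fadeL j)) fun ω hω => ?_
      · rintro j' rfl
        simpa [eq_comm] using hb'
      · simp only [fading, hω.2]
    · have hgeo : W.GeometryMeasurable (W.otherSigma (.fadeN j)) :=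
        W.geometryMeasurable_otherSigma (by simp) (by simp) (by simp)
      refine W.measure_servesInTier_inter_covered pol hM hT (.inl j) (W.otherSigma_le (.fadeN j))
        hgeo (fun b' hb' => W.measurable_interfPower_otherSigma hgeo ?_ (by simp)) (W.HN_meas j)
        (W.HN_law j) (W.indep_otherSigma (.fadeN j)) fun ω hω => ?_
      · rintro j' rfl
        simpa [eq_comm] using hb'
      · simp only [fading, hω.2]
    · exact hempty (eq_empty_of_forall_notMem fun ω hω => W.tier_inl_ne j ω hω.2)
  · have hA : ν ≠ .A → W.servesInTier ν (.inr i) = ∅ := fun hν =>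
      eq_empty_of_forall_notMem fun ω hω => hν hω.2.symm
    cases ν
    · exact hempty (hA (by simp))
    · exact hempty (hA (by simp))
    · have hgeo : W.GeometryMeasurable (W.otherSigma (.fadeA i)) :=
        W.geometryMeasurable_otherSigma (by simp) (by simp) (by simp)
      refine W.measure_servesInTier_inter_covered pol hM hT (.inr i) (W.otherSigma_le (.fadeA i))
        hgeo (fun b' hb' => W.measurable_interfPower_otherSigma hgeo (by simp) ?_) (W.HA_meas i)
        (W.HA_law i) (W.indep_otherSigma (.fadeA i)) fun ω hω => rfl
      rintro i' rfl
      simpa [eq_comm] using hb'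

lemma measurable_erlangTail (n : ℕ) (r : ℝ) : Measurable (erlangTail n r) := by
  have h : Measurable (expNeg r) := expNegDeriv_zero r ▸ measurable_expNegDeriv_right 0 r
  unfold erlangTail
  exact Finset.measurable_fun_sum _ fun k _ =>
    ((((ENNReal.measurable_toReal.const_mul r).pow_const k).div_const _).mul h)

lemma coverage_eq_integral_erlangTail [IsProbabilityMeasure P] (pol : Policy) {ν : Tier} {M : ℕ}
    (hM : p.m ν = M) {T : ℝ} (hT : 0 < T) :
    W.coverage pol ν T = ∫ ω, erlangTail M M
      (fadingThreshold p ν T (W.servDist ω) (W.interfNoise pol ω)) ∂(P[|W.assocEvent ν]) := by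
  have hM0 : (0 : ℝ) < M := hM ▸ p.m_pos ν
  have hA := W.geometryMeasurable.servesInTier ν
  have hC : MeasurableSet {ω | ENNReal.ofReal T ≤ W.sinr pol ω} :=
    measurableSet_le measurable_const (W.measurable_sinr pol)
  have hdisj := W.pairwise_disjoint_servesInTier ν
  have hsum : P (W.assocEvent ν ∩ {ω | ENNReal.ofReal T ≤ W.sinr pol ω}) =
      ∫⁻ ω in W.assocEvent ν, ENNReal.ofReal
        (erlangTail M M (fadingThreshold p ν T (W.servDist ω) (W.interfNoise pol ω))) ∂P := by
    have hdisj' : Pairwise (Function.onFun Disjoint fun b => W.servesInTier ν b ∩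
        {ω | ENNReal.ofReal T ≤ W.sinr pol ω}) := fun b b' hbb' =>
      (hdisj hbb').mono inter_subset_left inter_subset_left
    rw [assocEvent_eq_iUnion, lintegral_iUnion hA hdisj, iUnion_inter,
      measure_iUnion hdisj' fun b => (hA b).inter hC]
    exact tsum_congr (W.measure_servesInTier_inter_covered_eq pol hM hT)
  have hm : Measurable fun ω => erlangTail M M
      (fadingThreshold p ν T (W.servDist ω) (W.interfNoise pol ω)) :=
    (measurable_erlangTail M M).comp
      (measurable_fadingThreshold p ν T W.measurable_servDist (W.measurable_interfNoise pol))
  rw [coverage, measureReal_def, cond_apply (W.measurableSet_assocEvent ν), hsum,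
    integral_eq_lintegral_of_nonneg_ae
      (Filter.Eventually.of_forall fun ω => erlangTail_nonneg M hM0 _) hm.aestronglyMeasurable,
    ProbabilityTheory.cond, lintegral_smul_measure, smul_eq_mul]

/-! ### Disintegration along the serving distance -/

lemma erlangTail_fadingThreshold (ν : Tier) (M : ℕ) {T r : ℝ} (hT : 0 < T) (hr : 0 < r)
    (v : ℝ≥0∞) :
    erlangTail M M (fadingThreshold p ν T r v) =
      ∑ k ∈ Finset.range M, (-1 : ℝ) ^ k / (k.factorial : ℝ) * ((M : ℝ) * T / p.mu ν) ^ k *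
        (r ^ ((k : ℝ) * p.alpha ν) * expNegDeriv k ((M : ℝ) * T * r ^ p.alpha ν / p.mu ν) v) := by
  have hμ := p.mu_pos ν
  have ha : 0 < T * r ^ p.alpha ν / p.mu ν := by positivity
  unfold erlangTail
  refine Finset.sum_congr rfl fun k _ => ?_
  have hpow : r ^ ((k : ℝ) * p.alpha ν) = (r ^ p.alpha ν) ^ k := by
    rw [mul_comm, Real.rpow_mul hr.le, Real.rpow_natCast]
  rw [hpow]
  by_cases hv : v = ∞
  · subst hv
    rw [expNegDeriv_top, fadingThreshold, ENNReal.mul_top (ENNReal.ofReal_pos.2 ha).ne']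
    simp [expNeg]
  · have hz : fadingThreshold p ν T r v ≠ ∞ := ENNReal.mul_ne_top ENNReal.ofReal_ne_top hv
    rw [expNegDeriv_of_ne_top _ _ hv, expNeg, if_neg hz, fadingThreshold, ENNReal.toReal_mul,
      ENNReal.toReal_ofReal ha.le]
    have hexp : (M : ℝ) * (T * r ^ p.alpha ν / p.mu ν * v.toReal) =
        (M : ℝ) * T * r ^ p.alpha ν / p.mu ν * v.toReal := by ring
    rw [hexp, neg_pow v.toReal k]
    have h1 : ((-1 : ℝ) ^ k) * (-1) ^ k = 1 := by rw [← mul_pow]; simp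
    calc _ = ((-1 : ℝ) ^ k * (-1) ^ k) * (((M : ℝ) * T * r ^ p.alpha ν / p.mu ν * v.toReal) ^ k /
          k.factorial * Real.exp (-((M : ℝ) * T * r ^ p.alpha ν / p.mu ν * v.toReal))) := by
          rw [h1, one_mul]
      _ = _ := by ring

lemma condLaplace_interfNoise [IsFiniteMeasure P] (pol : Policy) (ν : Tier) :
    ∀ᵐ r ∂(W.servDistLaw ν), ∀ s : ℝ, 0 < s →
      W.condLaplace (W.interfNoise pol) ν r s =
        Real.exp (-(p.sigma2 * s)) * W.condLaplace (W.interference pol) ν r s := by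
  have hadd : Measurable fun v : ℝ≥0∞ => v + ENNReal.ofReal p.sigma2 := by fun_prop
  have h := condDistrib_comp (mβ := inferInstance) (μ := P[|W.assocEvent ν]) W.servDist
    (W.measurable_interference pol).aemeasurable hadd
  filter_upwards [h] with r hr s _
  unfold condLaplace
  have hexp : Measurable (expNeg s) := expNegDeriv_zero s ▸ measurable_expNegDeriv_right 0 s
  change ∫ v, expNeg s v ∂(condDistrib ((fun v => v + ENNReal.ofReal p.sigma2) ∘
    W.interference pol) W.servDist (P[|W.assocEvent ν]) r) = _
  rw [hr, Kernel.map_apply _ hadd, integral_map hadd.aemeasurable hexp.aestronglyMeasurable,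
    ← integral_const_mul]
  refine integral_congr_ae (Filter.Eventually.of_forall fun v => ?_)
  by_cases hv : v = ∞
  · simp [expNeg, hv]
  · have hv' : v + ENNReal.ofReal p.sigma2 ≠ ∞ := ENNReal.add_ne_top.2 ⟨hv, ENNReal.ofReal_ne_top⟩
    simp only [expNeg, if_neg hv, if_neg hv']
    rw [ENNReal.toReal_add hv ENNReal.ofReal_ne_top, ENNReal.toReal_ofReal p.sigma2_nonneg,
      ← Real.exp_add]
    congr 1
    ring

end Network

/-- The weight `r ^ (k α)` compensates the bound `k! / s ^ k` of the `k`-th derivative at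
`s = c r ^ α`. -/
lemma norm_rpow_mul_expNegDeriv_le (k : ℕ) {α c r : ℝ} (hc : 0 < c) (hr : 0 < r) (v : ℝ≥0∞) :
    ‖r ^ ((k : ℝ) * α) * expNegDeriv k (c * r ^ α) v‖ ≤ k.factorial / c ^ k := by
  have hpow : r ^ ((k : ℝ) * α) = (r ^ α) ^ k := by
    rw [mul_comm, Real.rpow_mul hr.le, Real.rpow_natCast]
  have hrα : 0 < r ^ α := by positivity
  rw [hpow, norm_mul, Real.norm_of_nonneg (by positivity)]
  calc (r ^ α) ^ k * ‖expNegDeriv k (c * r ^ α) v‖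
      ≤ (r ^ α) ^ k * (k.factorial / (c * r ^ α) ^ k) := by
        gcongr
        exact norm_expNegDeriv_le k (by positivity) le_rfl v
    _ = k.factorial / c ^ k := by
        rw [mul_pow]
        field_simp

/-- The mean of a weighted derivative `expNegDeriv` is evaluated by conditioning on `R`. -/
lemma integral_rpow_mul_expNegDeriv {Ω : Type*} [MeasurableSpace Ω] (ρ : Measure Ω)
    [IsFiniteMeasure ρ] {R : Ω → ℝ} {V : Ω → ℝ≥0∞} (hR : Measurable R) (hV : Measurable V)
    (hpos : ∀ᵐ ω ∂ρ, 0 < R ω) (k : ℕ) {α c : ℝ} (hc : 0 < c) :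
    Integrable (fun ω => R ω ^ ((k : ℝ) * α) * expNegDeriv k (c * R ω ^ α) (V ω)) ρ ∧
    Integrable (fun r => r ^ ((k : ℝ) * α) *
      ∫ v, expNegDeriv k (c * r ^ α) v ∂(condDistrib V R ρ r)) (ρ.map R) ∧
    ∫ ω, R ω ^ ((k : ℝ) * α) * expNegDeriv k (c * R ω ^ α) (V ω) ∂ρ =
      ∫ r, r ^ ((k : ℝ) * α) * ∫ v, expNegDeriv k (c * r ^ α) v ∂(condDistrib V R ρ r)
        ∂(ρ.map R) := by
  set f : ℝ × ℝ≥0∞ → ℝ := fun q => q.1 ^ ((k : ℝ) * α) * expNegDeriv k (c * q.1 ^ α) q.2 with hf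
  have hfm : Measurable f := by
    have h1 : Measurable fun q : ℝ × ℝ≥0∞ => (c * q.1 ^ α, q.2) := by fun_prop
    exact (measurable_fst.pow_const _).mul ((measurable_expNegDeriv k).comp h1)
  have hpair : Measurable fun ω => (R ω, V ω) := hR.prodMk hV
  have hint : Integrable (fun ω => f (R ω, V ω)) ρ := by
    refine Integrable.of_bound (hfm.comp hpair).aestronglyMeasurable (k.factorial / c ^ k) ?_
    filter_upwards [hpos] with ω hω
    exact norm_rpow_mul_expNegDeriv_le k hc hω (V ω)
  have hcomp : Integrable f ((ρ.map R) ⊗ₘ condDistrib V R ρ) := by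
    rw [compProd_map_condDistrib hV.aemeasurable]
    exact (integrable_map_measure hfm.aestronglyMeasurable hpair.aemeasurable).2 hint
  have hinner : ∀ r, ∫ v, f (r, v) ∂(condDistrib V R ρ r) = r ^ ((k : ℝ) * α) *
      ∫ v, expNegDeriv k (c * r ^ α) v ∂(condDistrib V R ρ r) := by
    intro r
    simp only [hf]
    rw [integral_const_mul]
  refine ⟨hint, ?_, ?_⟩
  · exact (hcomp.integral_compProd).congr (Filter.Eventually.of_forall hinner)
  · calc ∫ ω, f (R ω, V ω) ∂ρ = ∫ q, f q ∂(ρ.map fun ω => (R ω, V ω)) :=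
          (integral_map hpair.aemeasurable hfm.aestronglyMeasurable).symm
      _ = ∫ r, ∫ v, f (r, v) ∂(condDistrib V R ρ r) ∂(ρ.map R) := by
          rw [← compProd_map_condDistrib hV.aemeasurable, Measure.integral_compProd hcomp]
      _ = _ := integral_congr_ae (Filter.Eventually.of_forall hinner)

end VHetNet

/-! ### The coverage probability -/

theorem theorem1 (p : VHetNet.Params) {Ω : Type*} [MeasurableSpace Ω]
    (P : Measure Ω) [IsProbabilityMeasure P] (W : VHetNet.Network p P)
    (pol : VHetNet.Policy) (ν : VHetNet.Tier) (M : ℕ) (hM : p.m ν = M)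
    (T : ℝ) (hT : 0 < T) (hE : 0 < P (W.assocEvent ν)) :
    -- the conditional law of the serving distance has a density, which lives on its range
    W.servDistLaw ν ≪ volume ∧
    W.servDistLaw ν (p.servRange ν)ᶜ = 0 ∧
    -- the Laplace transform of `V = I + σ²` factors
    (∀ᵐ r ∂(W.servDistLaw ν), ∀ s : ℝ, 0 < s →
      W.condLaplace (W.interfNoise pol) ν r s =
        Real.exp (-(p.sigma2 * s)) * W.condLaplace (W.interference pol) ν r s) ∧
    -- it is smooth, and all the integrals converge
    (∀ r : ℝ, ContDiffOn ℝ (⊤ : ℕ∞) (W.condLaplace (W.interfNoise pol) ν r) (Ioi 0)) ∧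
    (∀ k : ℕ, IntegrableOn (fun r : ℝ => r ^ ((k : ℝ) * p.alpha ν) *
        iteratedDeriv k (W.condLaplace (W.interfNoise pol) ν r)
          ((M : ℝ) * T * r ^ p.alpha ν / p.mu ν) *
        W.servDistDensity ν r) (p.servRange ν)) ∧
    -- the coverage probability
    W.coverage pol ν T =
      ∑ k ∈ Finset.range M, (-1 : ℝ) ^ k / (k.factorial : ℝ) *
        ((M : ℝ) * T / p.mu ν) ^ k *
        ∫ r in p.servRange ν, r ^ ((k : ℝ) * p.alpha ν) *
          iteratedDeriv k (W.condLaplace (W.interfNoise pol) ν r)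
            ((M : ℝ) * T * r ^ p.alpha ν / p.mu ν) *
          W.servDistDensity ν r := by
  have hρ : IsProbabilityMeasure (P[|W.assocEvent ν]) := cond_isProbabilityMeasure hE.ne'
  have hac := W.servDistLaw_absolutelyContinuous ν
  have hrange := W.servDistLaw_compl_servRange ν
  have hM0 : (0 : ℝ) < M := hM ▸ p.m_pos ν
  have hμ := p.mu_pos ν
  have hc : 0 < (M : ℝ) * T / p.mu ν := by positivity
  have hfin : IsFiniteMeasure (W.servDistLaw ν) := by
    unfold VHetNet.Network.servDistLaw
    infer_instance
  have hpos : ∀ᵐ ω ∂(P[|W.assocEvent ν]), 0 < W.servDist ω := by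
    filter_upwards [W.ae_servDist_mem_servRange ν] with ω hω
    exact p.servRange_subset_Ioi ν hω
  have hs : ∀ r : ℝ, (M : ℝ) * T * r ^ p.alpha ν / p.mu ν =
      (M : ℝ) * T / p.mu ν * r ^ p.alpha ν := fun r => by ring
  have key := fun k : ℕ => VHetNet.integral_rpow_mul_expNegDeriv (P[|W.assocEvent ν])
    W.measurable_servDist (W.measurable_interfNoise pol) hpos k (α := p.alpha ν) hc
  set F : ℕ → ℝ → ℝ := fun k r => r ^ ((k : ℝ) * p.alpha ν) *
    ∫ v, VHetNet.expNegDeriv k ((M : ℝ) * T / p.mu ν * r ^ p.alpha ν) v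
      ∂(condDistrib (W.interfNoise pol) W.servDist (P[|W.assocEvent ν]) r) with hF
  have hcongr : ∀ k : ℕ, EqOn (fun r : ℝ => r ^ ((k : ℝ) * p.alpha ν) *
        iteratedDeriv k (W.condLaplace (W.interfNoise pol) ν r)
          ((M : ℝ) * T * r ^ p.alpha ν / p.mu ν) * W.servDistDensity ν r)
      (fun r => ((W.servDistLaw ν).rnDeriv volume r).toReal * F k r) (p.servRange ν) := by
    intro k r hr
    have hr0 : 0 < r := p.servRange_subset_Ioi ν hr
    have hd := VHetNet.iteratedDeriv_integral_expNeg
      (condDistrib (W.interfNoise pol) W.servDist (P[|W.assocEvent ν]) r) k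
      ((M : ℝ) * T / p.mu ν * r ^ p.alpha ν) (by positivity)
    have hL : W.condLaplace (W.interfNoise pol) ν r = fun s => ∫ v, VHetNet.expNeg s v
      ∂(condDistrib (W.interfNoise pol) W.servDist (P[|W.assocEvent ν]) r) := rfl
    simp only [hF, hs, hL, hd, VHetNet.Network.servDistDensity]
    ring
  have hFint : ∀ k, Integrable (fun r => ((W.servDistLaw ν).rnDeriv volume r).toReal * F k r) :=
    fun k => (integrable_toReal_rnDeriv_mul_iff hac).2 (key k).2.1
  refine ⟨hac, hrange, W.condLaplace_interfNoise pol ν,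
    fun r => VHetNet.contDiffOn_integral_expNeg _, fun k => ?_, ?_⟩
  · exact (integrableOn_congr_fun (hcongr k) (p.measurableSet_servRange ν)).2
      (hFint k).integrableOn
  · have hval : ∀ k : ℕ, ∫ r in p.servRange ν, r ^ ((k : ℝ) * p.alpha ν) *
        iteratedDeriv k (W.condLaplace (W.interfNoise pol) ν r)
          ((M : ℝ) * T * r ^ p.alpha ν / p.mu ν) * W.servDistDensity ν r =
        ∫ ω, W.servDist ω ^ ((k : ℝ) * p.alpha ν) * VHetNet.expNegDeriv k
          ((M : ℝ) * T / p.mu ν * W.servDist ω ^ p.alpha ν) (W.interfNoise pol ω)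
          ∂(P[|W.assocEvent ν]) := by
      intro k
      rw [setIntegral_congr_fun (p.measurableSet_servRange ν) (hcongr k),
        setIntegral_toReal_rnDeriv_mul hac (p.measurableSet_servRange ν),
        Measure.restrict_eq_self_of_ae_mem (s := p.servRange ν) hrange, (key k).2.2]
      rfl
    simp only [hval]
    rw [W.coverage_eq_integral_erlangTail pol hM hT]
    simp only [← integral_const_mul]
    rw [← integral_finsetSum _ fun k _ => ((key k).1.const_mul _)]
    refine integral_congr_ae ?_
    filter_upwards [hpos] with ω hω
    simp only [VHetNet.Network.erlangTail_fadingThreshold ν M hT hω, hs]
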